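/- Let $d\ge 3$ be an integer. Then the perfect matching entropy per vertex \[ \frac{\ln \operatorname{pm}(G)}{v(G)} \] is not estimable in the class of finite (non-empty) $d$-regular bipartite simple graphs $G$, where $\operatorname{pm}(G)$ is the number of perfect matchings of $G$ (which is positive for every such $G$) and $v(G)$ is the number of its vertices. Here, for a finite graph $G$, a finite rooted graph $\alpha$ and a positive integer $r$, let $\mathbb{P}(G,\alpha,r)$ be the probability that the $r$-ball centered at a uniform random vertex of $G$ is isomorphic to $\alpha$ as a rooted graph. A sequence $(G_n)$ of finite graphs is sparse if the set of degrees of vertices in the graphs $G_n$ is bounded, and a sparse sequence $(G_n)$ is Benjamini--Schramm convergent if $\mathbb{P}(G_n,\alpha,r)$ converges as $n\to\infty$ for every finite rooted graph $\alpha$ and every integer $r>0$. A graph parameter $p$ is estimable in a class $\mathcal{C}$ of finite graphs if $p(G_n)$ converges for every Benjamini--Schramm convergent sparse sequence $(G_n)$ of graphs in $\mathcal{C}$. -/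

import Mathlib

open Filter Topology

/-- A finite simple graph with at least one vertex. -/
structure FinGraph where
  V : Type
  [fintypeV : Fintype V]
  [nonemptyV : Nonempty V]
  graph : SimpleGraph V

attribute [instance] FinGraph.fintypeV FinGraph.nonemptyV

/-- A finite rooted graph. -/
structure RootedFinGraph extends FinGraph where
  root : V

namespace FinGraph

noncomputable section

/-- The vertices at distance at most `r` from `v`. -/
def ballSet (G : FinGraph) (v : G.V) (r : ℕ) : Set G.V :=
  {u | G.graph.edist v u ≤ (r : ℕ∞)}

theorem center_mem_ballSet (G : FinGraph) (v : G.V) (r : ℕ) : v ∈ G.ballSet v r := by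
  simp [ballSet]

/-- The `r`-ball of `G` centered at `v` (the induced subgraph, rooted at `v`) is isomorphic to `α`
as a rooted graph. -/
def BallIso (G : FinGraph) (v : G.V) (r : ℕ) (α : RootedFinGraph) : Prop :=
  ∃ φ : G.graph.induce (G.ballSet v r) ≃g α.graph,
    φ ⟨v, G.center_mem_ballSet v r⟩ = α.root

/-- The probability that the `r`-ball centered at a uniform random vertex of `G` is isomorphic
to `α` as a rooted graph. -/
def ballProb (G : FinGraph) (α : RootedFinGraph) (r : ℕ) : ℝ :=
  (Nat.card {v : G.V // G.BallIso v r α} : ℝ) / (Nat.card G.V : ℝ)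

open Classical in
/-- A sequence of finite graphs is sparse if its vertex degrees are uniformly bounded. -/
def Sparse (G : ℕ → FinGraph) : Prop :=
  ∃ D : ℕ, ∀ (n : ℕ) (v : (G n).V), (G n).graph.degree v ≤ D

/-- Benjamini–Schramm convergence (of a sparse graph sequence). -/
def BSConvergent (G : ℕ → FinGraph) : Prop :=
  ∀ (α : RootedFinGraph) (r : ℕ), 0 < r →
    ∃ l : ℝ, Tendsto (fun n => (G n).ballProb α r) atTop (𝓝 l)

/-- The graph parameter `p` is estimable in the class `C`: it converges along every
Benjamini–Schramm convergent sparse graph sequence in `C`. -/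
def Estimable (C : Set FinGraph) (p : FinGraph → ℝ) : Prop :=
  ∀ G : ℕ → FinGraph, (∀ n, G n ∈ C) → Sparse G → BSConvergent G →
    ∃ l : ℝ, Tendsto (fun n => p (G n)) atTop (𝓝 l)

/-- The number of perfect matchings of `G`. -/
def pm (G : FinGraph) : ℕ :=
  Nat.card {M : G.graph.Subgraph // M.IsPerfectMatching}

/-- The perfect matching entropy per vertex. It is meaningful when `G` has a perfect matching,
which is the case for every `d`-regular bipartite graph with `d ≥ 1`. -/
def pmEntropy (G : FinGraph) : ℝ :=
  Real.log (G.pm : ℝ) / (Nat.card G.V : ℝ)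

open Classical in
/-- The class of `d`-regular bipartite (finite, simple) graphs. -/
def regularBipartite (d : ℕ) : Set FinGraph :=
  {G | G.graph.IsBipartite ∧ G.graph.IsRegularOfDegree d}

end

end FinGraph

/-! ### Distance balls and their isomorphisms -/

namespace SimpleGraph

/-! Delete one edge 00 from `K_{d,d}` and string such blocks together, linking left vertex 0 of each
block to right vertex 0 of the next. Two families of `d`-regular bipartite graphs arise: `d`
disjoint cycles of blocks, or `d` parallel chains whose loose ends are absorbed by two extra
vertices of degree `d`. All but boundedly many vertices see the same bi-infinite chain, so both
families have the same local limit (`tendsto_ballProb`), and interleaving them gives a convergent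
sequence.

Perfect matchings nevertheless feel the global structure. Let `a` and `b` count the permutations of
`Fin d` that fix, respectively move, 0. A block matched internally has `b` matchings; one with both
links used has `a`. In the cycles all blocks can be matched internally, giving at least `b ^ (d * (n
+ 1))` matchings (`le_pm_cyclicRel`). In the parallel graph an extra vertex must be matched into
some chain. Each block has equally many left and right vertices, so that chain uses all of its links
and the others use none (`exists_block_perms`). Hence there are at most `d * (a * b ^ (d - 1)) ^ (n
+ 1)` matchings. Since `a < b` for `d ≥ 3`, the entropies stay apart by `(log b - log a) / (2 * d ^
2)` in the limit. -/

theorem edist_le_succ_iff {V : Type*} (G : SimpleGraph V) (v w : V) (s : ℕ) :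
    G.edist v w ≤ ((s + 1 : ℕ) : ℕ∞) ↔
      G.edist v w ≤ (s : ℕ∞) ∨ ∃ u, G.edist v u ≤ (s : ℕ∞) ∧ G.Adj u w := by
  constructor
  · intro h
    rw [edist_comm] at h
    have hne : G.edist w v ≠ ⊤ := ne_top_of_le_ne_top (ENat.natCast_ne_top _) h
    obtain ⟨p, hp⟩ := exists_walk_of_edist_ne_top hne
    cases p with
    | nil => left; simp
    | cons hadj q =>
      rename_i u
      right
      refine ⟨u, ?_, hadj.symm⟩
      rw [← hp, Walk.length_cons] at h
      rw [edist_comm]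
      refine (edist_le q).trans ?_
      have : q.length + 1 ≤ s + 1 := by exact_mod_cast h
      exact_mod_cast (by omega : q.length ≤ s)
  · rintro (h | ⟨u, hu, hadj⟩)
    · exact h.trans (by exact_mod_cast Nat.le_succ s)
    · refine (G.edist_triangle (v := u)).trans ?_
      rw [edist_eq_one_iff_adj.mpr hadj]
      push_cast
      gcongr

/-- A map which is injective, preserves and reflects adjacency, and lifts neighbours near `v`
identifies the `r`-ball around `v` with the `r`-ball around the image of `v`. -/
theorem exists_ball_iso {V W : Type*} (G : SimpleGraph V) (X : SimpleGraph W) (f : V → W)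
    (v : V) (w : W) (hw : f v = w) (r : ℕ) (S : ℕ → Set V) (hv : v ∈ S 0) (hmono : Monotone S)
    (hstep : ∀ s < r, ∀ p ∈ S s, ∀ q, G.Adj p q → q ∈ S (s + 1))
    (hadj : ∀ p ∈ S r, ∀ q ∈ S r, (X.Adj (f p) (f q) ↔ G.Adj p q))
    (hinj : Set.InjOn f (S r))
    (hlift : ∀ s < r, ∀ p ∈ S s, ∀ y, X.Adj (f p) y → ∃ q, G.Adj p q ∧ f q = y) :
    ∃ φ : G.induce {u | G.edist v u ≤ (r : ℕ∞)} ≃g X.induce {u | X.edist w u ≤ (r : ℕ∞)},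
      ∀ u, (φ u : W) = f u := by
  subst hw
  have hball : ∀ s ≤ r, ∀ u, G.edist v u ≤ (s : ℕ∞) → u ∈ S s := by
    intro s
    induction s with
    | zero =>
      intro _ u hu
      have : v = u := by simpa using hu
      exact this ▸ hv
    | succ s ih =>
      intro hs u hu
      rcases (edist_le_succ_iff G v u s).mp hu with h | ⟨p, hp, hpu⟩
      · exact hmono (Nat.le_succ s) (ih (by omega) u h)
      · exact hstep s (by omega) p (ih (by omega) p hp) u hpu
  -- The image of each ball is exactly a ball: edges lift from radius `s` to `s + 1`, so lifting is
  -- never needed at vertices on the boundary of the `r`-ball.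
  have himg : ∀ s ≤ r, ∀ y, X.edist (f v) y ≤ (s : ℕ∞) ↔
      ∃ q, G.edist v q ≤ (s : ℕ∞) ∧ f q = y := by
    intro s
    induction s with
    | zero =>
      intro _ y
      simp
    | succ s ih =>
      intro hs y
      rw [edist_le_succ_iff]
      constructor
      · rintro (h | ⟨u, hu, huy⟩)
        · obtain ⟨q, hq, rfl⟩ := (ih (by omega) y).mp h
          exact ⟨q, (edist_le_succ_iff G v q s).mpr (Or.inl hq), rfl⟩
        · obtain ⟨p, hp, rfl⟩ := (ih (by omega) u).mp hu
          obtain ⟨q, hpq, rfl⟩ := hlift s (by omega) p (hball s (by omega) p hp) y huy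
          exact ⟨q, (edist_le_succ_iff G v q s).mpr (Or.inr ⟨p, hp, hpq⟩), rfl⟩
      · rintro ⟨q, hq, rfl⟩
        have hqS := hmono hs (hball (s + 1) hs q hq)
        rcases (edist_le_succ_iff G v q s).mp hq with h | ⟨p, hp, hpq⟩
        · exact Or.inl ((ih (by omega) _).mpr ⟨q, h, rfl⟩)
        · refine Or.inr ⟨f p, (ih (by omega) _).mpr ⟨p, hp, rfl⟩, ?_⟩
          exact (hadj p (hmono (by omega) (hball s (by omega) p hp)) q hqS).mpr hpq
  let g : {u | G.edist v u ≤ (r : ℕ∞)} → {u | X.edist (f v) u ≤ (r : ℕ∞)} :=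
    fun u => ⟨f u, (himg r le_rfl _).mpr ⟨u, u.2, rfl⟩⟩
  have hg : Function.Bijective g := by
    constructor
    · intro a b hab
      exact Subtype.ext (hinj (hball r le_rfl _ a.2) (hball r le_rfl _ b.2)
        (congrArg Subtype.val hab))
    · rintro ⟨y, hy⟩
      obtain ⟨q, hq, rfl⟩ := (himg r le_rfl y).mp hy
      exact ⟨⟨q, hq⟩, rfl⟩
  refine ⟨⟨Equiv.ofBijective g hg, ?_⟩, fun u => rfl⟩
  intro a b
  exact hadj _ (hball r le_rfl _ a.2) _ (hball r le_rfl _ b.2)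

/-! ### Bipartite graphs of relations -/

/-- The bipartite graph of a relation: `(false, x)` is adjacent to `(true, y)` iff `A x y`. -/
def bipGraph {ι : Type*} (A : ι → ι → Prop) : SimpleGraph (Bool × ι) where
  Adj p q := (p.1 = false ∧ q.1 = true ∧ A p.2 q.2) ∨ (p.1 = true ∧ q.1 = false ∧ A q.2 p.2)
  symm := ⟨fun _ _ h => h.elim (fun h => Or.inr ⟨h.2.1, h.1, h.2.2⟩)
    (fun h => Or.inl ⟨h.2.1, h.1, h.2.2⟩)⟩
  loopless := ⟨by rintro ⟨_ | _, _⟩ <;> simp⟩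

section

variable {ι : Type*} {A : ι → ι → Prop} {x y : ι}

@[simp]
theorem bipGraph_adj_false_true : (bipGraph A).Adj (false, x) (true, y) ↔ A x y := by
  simp [bipGraph]

@[simp]
theorem bipGraph_adj_true_false : (bipGraph A).Adj (true, x) (false, y) ↔ A y x := by
  simp [bipGraph]

@[simp]
theorem bipGraph_adj_same (s : Bool) : ¬ (bipGraph A).Adj (s, x) (s, y) := by
  cases s <;> simp [bipGraph]

theorem bipGraph_isBipartite : (bipGraph A).IsBipartite :=
  ⟨Coloring.mk (fun p => if p.1 then 1 else 0) (by
    rintro ⟨_ | _, x⟩ ⟨_ | _, y⟩ h <;> simp_all)⟩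

theorem degree_eq_of_injective {V : Type*} (G : SimpleGraph V) (v : V)
    [Fintype (G.neighborSet v)] {d : ℕ} (f : Fin d → V) (hf : Function.Injective f)
    (hr : ∀ u, G.Adj v u ↔ ∃ k, f k = u) : G.degree v = d := by
  rw [← card_neighborSet_eq_degree]
  have : Function.Bijective
      (fun k => ⟨f k, (hr _).mpr ⟨k, rfl⟩⟩ : Fin d → G.neighborSet v) := by
    constructor
    · intro a b hab
      exact hf (congrArg Subtype.val hab)
    · rintro ⟨u, hu⟩
      obtain ⟨k, rfl⟩ := (hr u).mp hu
      exact ⟨k, rfl⟩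
  rw [← Fintype.card_of_bijective this, Fintype.card_fin]

open Classical in
theorem bipGraph_isRegularOfDegree [Fintype ι] {d : ℕ} (f g : ι → Fin d → ι)
    (hf : ∀ x, Function.Injective (f x)) (hg : ∀ x, Function.Injective (g x))
    (hfA : ∀ x y, A x y ↔ ∃ k, f x k = y) (hgA : ∀ x y, A x y ↔ ∃ k, g y k = x) :
    (bipGraph A).IsRegularOfDegree d := by
  rintro ⟨_ | _, x⟩
  · refine degree_eq_of_injective _ _ (fun k => (true, f x k))
      (fun a b h => hf x (Prod.ext_iff.mp h).2) ?_
    rintro ⟨_ | _, y⟩ <;> simp [hfA]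
  · refine degree_eq_of_injective _ _ (fun k => (false, g x k))
      (fun a b h => hg x (Prod.ext_iff.mp h).2) ?_
    rintro ⟨_ | _, y⟩ <;> simp [hgA]

end

end SimpleGraph

open SimpleGraph

/-! ### Chains of blocks and their local structure -/

/-- Adjacency in the bi-infinite chain of copies of `K_{d,d}` minus the edge `00`, where the left
vertex `0` of each block is joined to the right vertex `0` of the next block. -/
def blockRel {d : ℕ} [NeZero d] (x y : ℤ × Fin d) : Prop :=
  (y.1 = x.1 ∧ ¬ (x.2 = 0 ∧ y.2 = 0)) ∨ (y.1 = x.1 + 1 ∧ x.2 = 0 ∧ y.2 = 0)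

/-- A relation which, away from the ends, consists of `d` chains of `n` blocks. -/
structure IsBlockChain {d n : ℕ} [NeZero d] {E : Type}
    (A : (Fin d × Fin n × Fin d) ⊕ E → (Fin d × Fin n × Fin d) ⊕ E → Prop) : Prop where
  fwd : ∀ c (i : Fin n) j y, (i : ℕ) + 1 < n →
    (A (.inl (c, i, j)) y ↔ ∃ i' k, y = .inl (c, i', k) ∧ blockRel ((i : ℤ), j) ((i' : ℤ), k))
  bwd : ∀ c (i : Fin n) j y, 0 < (i : ℕ) →
    (A y (.inl (c, i, j)) ↔ ∃ i' k, y = .inl (c, i', k) ∧ blockRel ((i' : ℤ), k) ((i : ℤ), j))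

namespace IsBlockChain

variable {d n : ℕ} [NeZero d] {E : Type}
  {A : (Fin d × Fin n × Fin d) ⊕ E → (Fin d × Fin n × Fin d) ⊕ E → Prop}

/-- Left vertices are governed by `fwd` and right vertices by `bwd`; both apply only in blocks that
are neither first nor last. -/
theorem adj_iff (hA : IsBlockChain A) {c : Fin d} {i : Fin n} {j : Fin d} {s : Bool}
    (h0 : 0 < (i : ℕ)) (h1 : (i : ℕ) + 1 < n) (q : Bool × ((Fin d × Fin n × Fin d) ⊕ E)) :
    (bipGraph A).Adj (s, .inl (c, i, j)) q ↔ ∃ t i' k, q = (t, .inl (c, i', k)) ∧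
      (bipGraph blockRel).Adj (s, ((i : ℤ), j)) (t, ((i' : ℤ), k)) := by
  obtain ⟨t, y⟩ := q
  cases s <;> cases t <;> simp [hA.fwd c i j y h1, hA.bwd c i j y h0]

theorem blockRel_sub (s t : Bool) (a b z : ℤ) (j k : Fin d) :
    (bipGraph blockRel).Adj (s, (a - z, j)) (t, (b - z, k)) ↔
      (bipGraph blockRel).Adj (s, (a, j)) (t, (b, k)) := by
  have h (a b : ℤ) : b - z = a - z ↔ b = a := by omega
  have h' (a b : ℤ) : b - z = a - z + 1 ↔ b = a + 1 := by omega
  cases s <;> cases t <;> simp [blockRel, h, h']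

theorem blockRel_near {s t : Bool} {a b : ℤ} {j k : Fin d}
    (h : (bipGraph blockRel).Adj (s, (a, j)) (t, (b, k))) : |b - a| ≤ 1 := by
  rw [abs_le]
  cases s <;> cases t <;> simp [blockRel] at h <;> omega

/-- An edge moves at most one block, so a ball centered more than `r` blocks from the first and last
ones never reaches them. Translation invariance then moves its center to block 0. -/
theorem exists_ball_iso (hA : IsBlockChain A) (r : ℕ) (s : Bool) (c : Fin d) (i : Fin n) (j : Fin d)
    (h0 : r < (i : ℕ)) (h1 : (i : ℕ) + r + 1 < n) :
    ∃ φ : (bipGraph A).induce {u | (bipGraph A).edist (s, .inl (c, i, j)) u ≤ (r : ℕ∞)} ≃g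
      (bipGraph blockRel).induce {u | (bipGraph blockRel).edist (s, ((0 : ℤ), j)) u ≤ (r : ℕ∞)},
      (φ ⟨(s, .inl (c, i, j)), by simp⟩ : Bool × ℤ × Fin d) = (s, (0, j)) := by
  -- The value on the extra vertices is arbitrary: the sets `S m` avoid them.
  let f : Bool × ((Fin d × Fin n × Fin d) ⊕ E) → Bool × ℤ × Fin d := fun p =>
    (p.1, p.2.elim (fun x => ((x.2.1 : ℤ) - (i : ℤ), x.2.2)) (fun _ => (0, 0)))
  let S : ℕ → Set (Bool × ((Fin d × Fin n × Fin d) ⊕ E)) := fun m =>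
    {p | ∃ (t : Bool) (i' : Fin n) (k : Fin d), p = (t, .inl (c, i', k)) ∧ |(i' : ℤ) - i| ≤ m}
  have hf : f (s, .inl (c, i, j)) = (s, (0, j)) := by simp [f]
  have key : ∀ m ≤ r, ∀ i' : Fin n, |(i' : ℤ) - i| ≤ m → 0 < (i' : ℕ) ∧ (i' : ℕ) + 1 < n := by
    intro m hm i' h
    rw [abs_le] at h
    omega
  obtain ⟨φ, hφ⟩ := SimpleGraph.exists_ball_iso (bipGraph A) (bipGraph blockRel) f
    (s, .inl (c, i, j)) (s, (0, j)) hf r S ⟨s, i, j, rfl, by simp⟩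
    (by
      rintro m m' hm p ⟨t, i', k, rfl, h⟩
      exact ⟨t, i', k, rfl, h.trans (by exact_mod_cast hm)⟩)
    (by
      rintro m hm p ⟨t, i', k, rfl, h⟩ q hpq
      obtain ⟨hi0, hi1⟩ := key m hm.le i' h
      obtain ⟨t', i'', k', rfl, hq⟩ := (hA.adj_iff hi0 hi1 q).mp hpq
      refine ⟨t', i'', k', rfl, ?_⟩
      have := blockRel_near hq
      rw [abs_le] at *
      push_cast
      constructor <;> omega)
    (by
      rintro p ⟨t, i', k, rfl, h⟩ q ⟨t', i'', k', rfl, h'⟩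
      obtain ⟨hi0, hi1⟩ := key r le_rfl i' h
      rw [hA.adj_iff hi0 hi1]
      simp only [f, Sum.elim_inl, blockRel_sub]
      constructor
      · exact fun h => ⟨_, _, _, rfl, h⟩
      · rintro ⟨_, _, _, h1, h2⟩
        simp only [Prod.mk.injEq, Sum.inl.injEq] at h1
        obtain ⟨rfl, _, rfl, rfl⟩ := h1
        exact h2)
    (by
      rintro p ⟨t, i', k, rfl, h⟩ q ⟨t', i'', k', rfl, h'⟩ he
      simp only [f, Sum.elim_inl, Prod.mk.injEq] at he
      obtain ⟨rfl, he, rfl⟩ := he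
      have : i' = i'' := Fin.ext (by omega)
      rw [this])
    (by
      rintro m hm p ⟨t, i', k, rfl, h⟩ ⟨t', z, k'⟩ hy
      obtain ⟨hi0, hi1⟩ := key m hm.le i' h
      have hz : z = z + i - i := by ring
      simp only [f, Sum.elim_inl] at hy
      rw [hz, blockRel_sub] at hy
      have hn := blockRel_near hy
      rw [abs_le] at hn
      refine ⟨(t', .inl (c, ⟨(z + i).toNat, by omega⟩, k')), ?_, ?_⟩
      · rw [hA.adj_iff hi0 hi1]
        refine ⟨_, _, _, rfl, ?_⟩
        simpa [show max (z + (i : ℤ)) 0 = z + i by omega] using hy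
      · simp [f, show max (z + (i : ℤ)) 0 = z + i by omega])
  exact ⟨φ, (hφ _).trans hf⟩

end IsBlockChain

/-! ### Ball statistics and the common local limit -/

/-- The `r`-ball at the vertex `t` of block `0` of the bi-infinite chain is isomorphic to `α`. -/
def ChainBallIso {d : ℕ} [NeZero d] (α : RootedFinGraph) (r : ℕ) (t : Bool × Fin d) : Prop :=
  ∃ φ : (bipGraph (blockRel (d := d))).induce
      {u | (bipGraph (blockRel (d := d))).edist (t.1, ((0 : ℤ), t.2)) u ≤ (r : ℕ∞)} ≃g α.graph,
    φ ⟨(t.1, (0, t.2)), by simp⟩ = α.root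

/-- The finite graph of a relation on a non-empty finite type. -/
def bipFinGraph {ι : Type} [Fintype ι] [Nonempty ι] (A : ι → ι → Prop) : FinGraph where
  V := Bool × ι
  graph := bipGraph A

theorem ballIso_iff_chainBallIso {d n : ℕ} [NeZero d] {E : Type} [Fintype E] [NeZero n]
    {A : (Fin d × Fin n × Fin d) ⊕ E → (Fin d × Fin n × Fin d) ⊕ E → Prop}
    (hA : IsBlockChain A) (α : RootedFinGraph) (r : ℕ) (s : Bool) (c : Fin d) (i : Fin n) (j : Fin d)
    (h0 : r < (i : ℕ)) (h1 : (i : ℕ) + r + 1 < n) :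
    (bipFinGraph A).BallIso (s, .inl (c, i, j)) r α ↔ ChainBallIso α r (s, j) := by
  obtain ⟨φ, hφ⟩ := hA.exists_ball_iso r s c i j h0 h1
  constructor
  · rintro ⟨ψ, hψ⟩
    refine ⟨φ.symm.trans ψ, ?_⟩
    rw [← hψ]
    refine congrArg ψ (φ.symm_apply_eq.mpr (Subtype.ext hφ.symm))
  · rintro ⟨ψ, hψ⟩
    refine ⟨φ.trans ψ, ?_⟩
    rw [← hψ]
    exact congrArg ψ (Subtype.ext hφ)

/-- Exceptional vertices lie in the first or last `r + 1` blocks or in `E`. Covering them by the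
image of a type of size independent of `n` bounds their number; `g` need not be injective. -/
theorem exists_interior_of_notMem_image {d n : ℕ} {E : Type} (r : ℕ) [NeZero n] :
    ∃ g : Bool × ((Fin d × (Fin (r + 1) × Bool) × Fin d) ⊕ E) →
        Bool × ((Fin d × Fin n × Fin d) ⊕ E),
      ∀ v, (¬ ∃ u, g u = v) → ∃ s c i j, v = (s, .inl (c, i, j)) ∧
        r < (i : ℕ) ∧ (i : ℕ) + r + 1 < n := by
  have hn : 0 < n := Nat.pos_of_neZero n
  -- The Boolean selects the end of the chain; `min` and truncated subtraction keep the index in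
  -- range for short chains.
  refine ⟨fun u => (u.1, u.2.map (fun x => (x.1,
    if x.2.1.2 then ⟨min x.2.1.1 (n - 1), by omega⟩ else ⟨n - 1 - x.2.1.1, by omega⟩, x.2.2)) id),
    ?_⟩
  rintro ⟨s, ⟨c, i, j⟩ | e⟩ hv
  · refine ⟨s, c, i, j, rfl, ?_, ?_⟩
    · by_contra h
      refine hv ⟨(s, .inl (c, (⟨i, by omega⟩, true), j)), ?_⟩
      simp only [Sum.map_inl, if_true, Prod.mk.injEq, Sum.inl.injEq, true_and, and_true]
      exact Fin.ext (by simp; omega)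
    · by_contra h
      refine hv ⟨(s, .inl (c, (⟨n - 1 - i, by omega⟩, false), j)), ?_⟩
      simp only [Sum.map_inl, Bool.false_eq_true, if_false, Prod.mk.injEq, Sum.inl.injEq, true_and,
        and_true]
      exact Fin.ext (by simp; omega)
  · exact absurd ⟨(s, .inr e), rfl⟩ hv

/-- Away from the exceptional vertices the ball depends only on the position in the block, and there
are `d * n` blocks. -/
theorem card_ballIso_bounds {d n : ℕ} [NeZero d] {E : Type} [Fintype E] [NeZero n]
    {A : (Fin d × Fin n × Fin d) ⊕ E → (Fin d × Fin n × Fin d) ⊕ E → Prop}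
    (hA : IsBlockChain A) (α : RootedFinGraph) (r : ℕ) :
    Nat.card {v : (bipFinGraph A).V // (bipFinGraph A).BallIso v r α} ≤
        d * n * Nat.card {t : Bool × Fin d // ChainBallIso α r t} +
          2 * (d * (2 * (r + 1)) * d + Fintype.card E) ∧
      d * n * Nat.card {t : Bool × Fin d // ChainBallIso α r t} ≤
        Nat.card {v : (bipFinGraph A).V // (bipFinGraph A).BallIso v r α} +
          2 * (d * (2 * (r + 1)) * d + Fintype.card E) := by
  classical
  obtain ⟨g, hg⟩ := exists_interior_of_notMem_image (d := d) (n := n) (E := E) r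
  let Q : Finset (Bool × ((Fin d × Fin n × Fin d) ⊕ E)) :=
    Finset.univ.filter fun v => (bipFinGraph A).BallIso v r α
  let e : Fin d × Fin n × {t : Bool × Fin d // ChainBallIso α r t} →
      Bool × ((Fin d × Fin n × Fin d) ⊕ E) := fun x => (x.2.2.1.1, .inl (x.1, x.2.1, x.2.2.1.2))
  have he : Function.Injective e := by
    rintro ⟨c, i, ⟨⟨s, j⟩, h⟩⟩ ⟨c', i', ⟨⟨s', j'⟩, h'⟩⟩ heq
    simp only [e, Prod.mk.injEq, Sum.inl.injEq] at heq
    obtain ⟨rfl, rfl, rfl, rfl⟩ := heq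
    rfl
  have hQ : Nat.card {v : (bipFinGraph A).V // (bipFinGraph A).BallIso v r α} = Q.card := by
    rw [Nat.card_eq_fintype_card]
    exact Fintype.card_subtype _
  have hM : (Finset.univ.image e).card =
      d * n * Nat.card {t : Bool × Fin d // ChainBallIso α r t} := by
    rw [Finset.card_image_of_injective _ he, Finset.card_univ, Nat.card_eq_fintype_card]
    simp [mul_assoc]
  have hB : (Finset.univ.image g).card ≤ 2 * (d * (2 * (r + 1)) * d + Fintype.card E) := by
    refine Finset.card_image_le.trans (le_of_eq ?_)
    simp [mul_comm]
  have key : ∀ v ∉ Finset.univ.image g, (v ∈ Q ↔ v ∈ Finset.univ.image e) := by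
    intro v hv
    obtain ⟨s, c, i, j, rfl, h0, h1⟩ := hg v (by simpa using hv)
    simp only [Q, Finset.mem_filter, Finset.mem_univ, true_and, Finset.mem_image,
      ballIso_iff_chainBallIso hA α r s c i j h0 h1]
    constructor
    · exact fun h => ⟨(c, i, ⟨(s, j), h⟩), rfl⟩
    · rintro ⟨⟨c', i', ⟨⟨s', j'⟩, h'⟩⟩, heq⟩
      simp only [e, Prod.mk.injEq, Sum.inl.injEq] at heq
      obtain ⟨rfl, rfl, rfl, rfl⟩ := heq
      exact h'
  rw [hQ, ← hM]
  constructor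
  · refine (Finset.card_le_card (t := Finset.univ.image e ∪ Finset.univ.image g) ?_).trans
      ((Finset.card_union_le _ _).trans (by gcongr))
    intro v hv
    rw [Finset.mem_union]
    by_cases h : v ∈ Finset.univ.image g
    · exact Or.inr h
    · exact Or.inl ((key v h).mp hv)
  · refine (Finset.card_le_card (t := Q ∪ Finset.univ.image g) ?_).trans
      ((Finset.card_union_le _ _).trans (by gcongr))
    intro v hv
    rw [Finset.mem_union]
    by_cases h : v ∈ Finset.univ.image g
    · exact Or.inr h
    · exact Or.inl ((key v h).mpr hv)

theorem card_bipFinGraph {ι : Type} [Fintype ι] [Nonempty ι] (A : ι → ι → Prop) :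
    Nat.card (bipFinGraph A).V = 2 * Fintype.card ι := by
  change Nat.card (Bool × ι) = _
  simp

/-- The limit involves neither `A` nor `E`, so it is shared by both families. -/
theorem tendsto_ballProb {d : ℕ} [NeZero d] {E : Type} [Fintype E]
    (A : ∀ n : ℕ, (Fin d × Fin (n + 1) × Fin d) ⊕ E → (Fin d × Fin (n + 1) × Fin d) ⊕ E → Prop)
    (hA : ∀ n, IsBlockChain (A n)) (α : RootedFinGraph) (r : ℕ) :
    Tendsto (fun n => (bipFinGraph (A n)).ballProb α r) atTop
      (𝓝 ((Nat.card {t : Bool × Fin d // ChainBallIso α r t} : ℝ) / (2 * d))) := by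
  set m := Nat.card {t : Bool × Fin d // ChainBallIso α r t}
  set K := 2 * (d * (2 * (r + 1)) * d + Fintype.card E)
  have hd : (1 : ℝ) ≤ d := by exact_mod_cast Nat.pos_of_neZero d
  rw [tendsto_iff_norm_sub_tendsto_zero]
  have hlim : Tendsto (fun n : ℕ => ((K : ℝ) + m * Fintype.card E) * (1 / ((n : ℝ) + 1))) atTop
      (𝓝 0) := by
    simpa using tendsto_one_div_add_atTop_nhds_zero_nat.const_mul ((K : ℝ) + m * Fintype.card E)
  refine squeeze_zero (fun _ => norm_nonneg _) (fun n => ?_) hlim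
  obtain ⟨h1, h2⟩ := card_ballIso_bounds (hA n) α r
  rw [FinGraph.ballProb]
  have hV : (Nat.card (bipFinGraph (A n)).V : ℝ) = 2 * (d * (n + 1) * d + Fintype.card E) := by
    rw [card_bipFinGraph]
    simp [mul_assoc]
  rw [hV]
  set N := Nat.card {v : (bipFinGraph (A n)).V // (bipFinGraph (A n)).BallIso v r α}
  set e := Fintype.card E
  have h1 : (N : ℝ) ≤ d * (n + 1) * m + K := by exact_mod_cast h1
  have h2 : (d : ℝ) * (n + 1) * m ≤ N + K := by exact_mod_cast h2
  have he : (0 : ℝ) ≤ e := by positivity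
  have hm : (0 : ℝ) ≤ m := by positivity
  have hK : (0 : ℝ) ≤ K := by positivity
  have hn : (0 : ℝ) < (n : ℝ) + 1 := by positivity
  have hD : (n : ℝ) + 1 ≤ d * (n + 1) * d + e := by
    have : (n : ℝ) + 1 ≤ d * (n + 1) := le_mul_of_one_le_left hn.le hd
    have : (d : ℝ) * (n + 1) ≤ d * (n + 1) * d := le_mul_of_one_le_right (by positivity) hd
    linarith
  set D := (d : ℝ) * (n + 1) * d + e with hDdef
  have hD0 : 0 < D := hn.trans_le hD
  -- Two errors: the miscount of balls, at most `K`, and the `e` extra vertices in the denominator.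
  have hre : (N : ℝ) / (2 * D) - m / (2 * d) = ((N - d * (n + 1) * m) - m * e / d) / (2 * D) := by
    rw [hDdef] at hD0 ⊢
    field_simp
    ring
  have hme : (m : ℝ) * e / d ≤ m * e := div_le_self (by positivity) hd
  have hme' : 0 ≤ (m : ℝ) * e / d := by positivity
  rw [hre, Real.norm_eq_abs, abs_div, abs_of_pos (by positivity : 0 < 2 * D), mul_one_div]
  have habs : |((N : ℝ) - d * (n + 1) * m) - m * e / d| ≤ (K : ℝ) + m * e := by
    rw [abs_le]
    constructor <;> linarith
  gcongr
  linarith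

/-! ### Perfect matchings as permutations -/

theorem exists_perm_of_isPerfectMatching {ι : Type*} {A : ι → ι → Prop}
    {M : (bipGraph A).Subgraph} (hM : M.IsPerfectMatching) :
    ∃ σ : Equiv.Perm ι, (∀ x, A x (σ x)) ∧
      ∀ p q, M.Adj p q ↔ (bipGraph fun x y => σ x = y).Adj p q := by
  rw [Subgraph.isPerfectMatching_iff] at hM
  have hf : ∀ x, ∃ y, M.Adj (false, x) (true, y) := by
    intro x
    obtain ⟨⟨_ | _, y⟩, h, -⟩ := hM (false, x)
    · exact absurd h.adj_sub (bipGraph_adj_same _)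
    · exact ⟨y, h⟩
  have hg : ∀ y, ∃ x, M.Adj (true, y) (false, x) := by
    intro x
    obtain ⟨⟨_ | _, y⟩, h, -⟩ := hM (true, x)
    · exact ⟨y, h⟩
    · exact absurd h.adj_sub (bipGraph_adj_same _)
  choose f hf using hf
  choose g hg using hg
  have hfu : ∀ x y, M.Adj (false, x) (true, y) ↔ f x = y := by
    intro x y
    constructor
    · exact fun h => (Prod.ext_iff.mp ((hM (false, x)).unique (hf x) h)).2
    · rintro rfl
      exact hf x
  have hgu : ∀ x y, M.Adj (false, x) (true, y) ↔ g y = x := by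
    intro x y
    constructor
    · exact fun h => (Prod.ext_iff.mp ((hM (true, y)).unique (hg y) h.symm)).2
    · rintro rfl
      exact (hg y).symm
  refine ⟨⟨f, g, fun x => (hgu _ _).mp (hf x), fun y => (hfu _ _).mp (hg y).symm⟩, ?_, ?_⟩
  · exact fun x => bipGraph_adj_false_true.mp (hf x).adj_sub
  · rintro ⟨_ | _, x⟩ ⟨_ | _, y⟩
    · exact iff_of_false (fun h => bipGraph_adj_same _ h.adj_sub) (bipGraph_adj_same _)
    · simp [hfu]
    · rw [M.adj_comm]
      simp [hfu]
    · exact iff_of_false (fun h => bipGraph_adj_same _ h.adj_sub) (bipGraph_adj_same _)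

theorem bipGraph_perm_isPerfectMatching {ι : Type*} {A : ι → ι → Prop} (σ : Equiv.Perm ι)
    (h : bipGraph (fun x y => σ x = y) ≤ bipGraph A) :
    (SimpleGraph.toSubgraph _ h).IsPerfectMatching := by
  rw [Subgraph.isPerfectMatching_iff]
  rintro ⟨_ | _, x⟩
  · refine ⟨(true, σ x), by simp, ?_⟩
    rintro ⟨_ | _, y⟩ hy
    · exact absurd hy.adj_sub (bipGraph_adj_same _)
    · have : σ x = y := by simpa using hy
      rw [this]
  · refine ⟨(false, σ.symm x), by simp, ?_⟩
    rintro ⟨_ | _, y⟩ hy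
    · have : σ y = x := by simpa using hy
      rw [← this, Equiv.symm_apply_apply]
    · exact absurd hy.adj_sub (bipGraph_adj_same _)

theorem bipGraph_perm_le {ι : Type*} {A : ι → ι → Prop} {σ : Equiv.Perm ι}
    (h : ∀ x, A x (σ x)) : bipGraph (fun x y => σ x = y) ≤ bipGraph A := by
  rintro ⟨_ | _, x⟩ ⟨_ | _, y⟩ hxy
  · exact absurd hxy (bipGraph_adj_same _)
  · rw [bipGraph_adj_false_true] at hxy ⊢
    exact hxy ▸ h x
  · rw [bipGraph_adj_true_false] at hxy ⊢
    exact hxy ▸ h y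
  · exact absurd hxy (bipGraph_adj_same _)

/-- Perfect matchings of the bipartite graph of `A` correspond to permutations below `A`. -/
theorem pm_bipFinGraph {ι : Type} [Fintype ι] [Nonempty ι] (A : ι → ι → Prop) :
    (bipFinGraph A).pm = Nat.card {σ : Equiv.Perm ι // ∀ x, A x (σ x)} := by
  change Nat.card {M : (bipGraph A).Subgraph // M.IsPerfectMatching} = _
  symm
  refine Nat.card_congr (Equiv.ofBijective (fun σ =>
    ⟨_, bipGraph_perm_isPerfectMatching σ.1 (bipGraph_perm_le σ.2)⟩) ⟨?_, ?_⟩)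
  · intro σ τ h
    refine Subtype.ext (Equiv.ext fun x => ?_)
    have h1 : (SimpleGraph.toSubgraph _ (bipGraph_perm_le τ.2)).Adj (false, x) (true, σ.1 x) := by
      have h2 := congrArg Subtype.val h
      dsimp only at h2
      rw [← h2]
      simp
    change (bipGraph fun x y => τ.1 x = y).Adj _ _ at h1
    exact (bipGraph_adj_false_true.mp h1).symm
  · rintro ⟨M, hM⟩
    obtain ⟨σ, hσ, hadj⟩ := exists_perm_of_isPerfectMatching hM
    refine ⟨⟨σ, hσ⟩, Subtype.ext (Subgraph.ext ?_ ?_)⟩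
    · exact (Set.eq_univ_of_forall hM.2).symm
    · funext p q
      exact propext (hadj p q).symm

/-! ### The two families of regular graphs -/

/-- `d` disjoint cycles of `n + 1` blocks. -/
def cyclicRel (d n : ℕ) [NeZero d] :
    (Fin d × Fin (n + 1) × Fin d) ⊕ Empty → (Fin d × Fin (n + 1) × Fin d) ⊕ Empty → Prop
  | .inl (c, i, j), .inl (c', i', k) =>
    c' = c ∧ ((i' = i ∧ ¬ (j = 0 ∧ k = 0)) ∨ (i' = i + 1 ∧ j = 0 ∧ k = 0))

/-- `d` parallel chains of `n + 1` blocks, joining two extra vertices. -/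
def parallelRel (d n : ℕ) [NeZero d] :
    (Fin d × Fin (n + 1) × Fin d) ⊕ Unit → (Fin d × Fin (n + 1) × Fin d) ⊕ Unit → Prop
  | .inl (c, i, j), .inl (c', i', k) =>
    c' = c ∧ ((i' = i ∧ ¬ (j = 0 ∧ k = 0)) ∨ ((i' : ℕ) = i + 1 ∧ j = 0 ∧ k = 0))
  | .inl (_, i, j), .inr _ => i = Fin.last n ∧ j = 0
  | .inr _, .inl (_, i, k) => i = 0 ∧ k = 0
  | .inr _, .inr _ => False

section

variable {d n : ℕ} [NeZero d]

theorem isBlockChain_cyclicRel : IsBlockChain (cyclicRel d n) where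
  fwd := by
    rintro c i j (⟨c', i', k⟩ | ⟨⟨⟩⟩) hi
    have h : i' = i + 1 ↔ ((i' : ℕ) : ℤ) = (i : ℕ) + 1 := by
      rw [Fin.ext_iff, Fin.val_add_one_of_lt (by rw [Fin.lt_def]; simpa using hi)]
      omega
    have h' : i' = i ↔ ((i' : ℕ) : ℤ) = (i : ℕ) := by
      rw [Fin.ext_iff]
      omega
    simp only [cyclicRel, blockRel, h, h']
    constructor
    · rintro ⟨rfl, h⟩
      exact ⟨i', k, rfl, h⟩
    · rintro ⟨i', k, h1, h2⟩
      simp only [Sum.inl.injEq, Prod.mk.injEq] at h1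
      obtain ⟨rfl, rfl, rfl⟩ := h1
      exact ⟨rfl, h2⟩
  bwd := by
    rintro c i j (⟨c', i', k⟩ | ⟨⟨⟩⟩) hi
    -- Wrap-around from the last block would force `i = 0`, excluded by `hi`.
    have h : i = i' + 1 ↔ ((i : ℕ) : ℤ) = (i' : ℕ) + 1 := by
      rw [Fin.ext_iff, Fin.val_add_one]
      split_ifs with hl
      · subst hl
        have := i.2
        simp only [Fin.val_last]
        omega
      · omega
    have h' : i = i' ↔ ((i : ℕ) : ℤ) = (i' : ℕ) := by
      rw [Fin.ext_iff]
      omega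
    simp only [cyclicRel, blockRel, h, h']
    constructor
    · rintro ⟨rfl, h⟩
      exact ⟨i', k, rfl, h⟩
    · rintro ⟨i', k, h1, h2⟩
      simp only [Sum.inl.injEq, Prod.mk.injEq] at h1
      obtain ⟨rfl, rfl, rfl⟩ := h1
      exact ⟨rfl, h2⟩

theorem isBlockChain_parallelRel : IsBlockChain (parallelRel d n) where
  fwd := by
    rintro c i j (⟨c', i', k⟩ | _) hi
    · have h : (i' : ℕ) = i + 1 ↔ ((i' : ℕ) : ℤ) = (i : ℕ) + 1 := by omega
      have h' : i' = i ↔ ((i' : ℕ) : ℤ) = (i : ℕ) := by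
        rw [Fin.ext_iff]
        omega
      simp only [parallelRel, blockRel, h, h']
      constructor
      · rintro ⟨rfl, h⟩
        exact ⟨i', k, rfl, h⟩
      · rintro ⟨i', k, h1, h2⟩
        simp only [Sum.inl.injEq, Prod.mk.injEq] at h1
        obtain ⟨rfl, rfl, rfl⟩ := h1
        exact ⟨rfl, h2⟩
    · have : i ≠ Fin.last n := by
        rintro rfl
        simp at hi
      simp [parallelRel, this]
  bwd := by
    rintro c i j (⟨c', i', k⟩ | _) hi
    · have h : (i : ℕ) = i' + 1 ↔ ((i : ℕ) : ℤ) = (i' : ℕ) + 1 := by omega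
      have h' : i = i' ↔ ((i : ℕ) : ℤ) = (i' : ℕ) := by
        rw [Fin.ext_iff]
        omega
      simp only [parallelRel, blockRel, h, h']
      constructor
      · rintro ⟨rfl, h⟩
        exact ⟨i', k, rfl, h⟩
      · rintro ⟨i', k, h1, h2⟩
        simp only [Sum.inl.injEq, Prod.mk.injEq] at h1
        obtain ⟨rfl, rfl, rfl⟩ := h1
        exact ⟨rfl, h2⟩
    · have : i ≠ 0 := by
        rintro rfl
        simp at hi
      simp [parallelRel, this]

theorem cyclicRel_mem_regularBipartite :
    bipFinGraph (cyclicRel d n) ∈ FinGraph.regularBipartite d := by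
  refine ⟨bipGraph_isBipartite, bipGraph_isRegularOfDegree
    (fun x k => x.elim (fun x => .inl (x.1, if x.2.2 = 0 ∧ k = 0 then x.2.1 + 1 else x.2.1, k))
      Empty.elim)
    (fun x j => x.elim (fun x => .inl (x.1, if j = 0 ∧ x.2.2 = 0 then x.2.1 - 1 else x.2.1, j))
      Empty.elim) ?_ ?_ ?_ ?_⟩
  · rintro (⟨c, i, j⟩ | ⟨⟨⟩⟩) k k' h
    simp only [Sum.elim_inl, Sum.inl.injEq, Prod.mk.injEq] at h
    exact h.2.2
  · rintro (⟨c, i, j⟩ | ⟨⟨⟩⟩) k k' h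
    simp only [Sum.elim_inl, Sum.inl.injEq, Prod.mk.injEq] at h
    exact h.2.2
  · rintro (⟨c, i, j⟩ | ⟨⟨⟩⟩) (⟨c', i', k⟩ | ⟨⟨⟩⟩)
    simp only [cyclicRel, Sum.elim_inl, Sum.inl.injEq, Prod.mk.injEq]
    by_cases hjk : j = 0 ∧ k = 0
    · constructor
      · rintro ⟨rfl, h⟩
        exact ⟨k, rfl, by simp_all, rfl⟩
      · rintro ⟨_, rfl, h, rfl⟩
        simp_all
    · constructor
      · rintro ⟨rfl, h⟩
        exact ⟨k, rfl, by rw [if_neg hjk]; tauto, rfl⟩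
      · rintro ⟨_, rfl, h, rfl⟩
        rw [if_neg hjk] at h
        exact ⟨rfl, Or.inl ⟨h.symm, hjk⟩⟩
  · rintro (⟨c, i, j⟩ | ⟨⟨⟩⟩) (⟨c', i', k⟩ | ⟨⟨⟩⟩)
    simp only [cyclicRel, Sum.elim_inl, Sum.inl.injEq, Prod.mk.injEq]
    by_cases hjk : j = 0 ∧ k = 0
    · constructor
      · rintro ⟨rfl, h⟩
        exact ⟨j, rfl, by simp_all, rfl⟩
      · rintro ⟨_, rfl, h, rfl⟩
        rw [if_pos hjk] at h
        exact ⟨rfl, Or.inr ⟨by rw [← h, sub_add_cancel], hjk⟩⟩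
    · constructor
      · rintro ⟨rfl, h⟩
        exact ⟨j, rfl, by rw [if_neg hjk]; tauto, rfl⟩
      · rintro ⟨_, rfl, h, rfl⟩
        rw [if_neg hjk] at h
        exact ⟨rfl, Or.inl ⟨h, hjk⟩⟩

/-- Links, or an extra vertex at the ends, restore the degree lost with the edge 00. Taking exactly
`d` chains gives the extra vertices degree `d`. -/
theorem parallelRel_mem_regularBipartite :
    bipFinGraph (parallelRel d n) ∈ FinGraph.regularBipartite d := by
  refine ⟨bipGraph_isBipartite, bipGraph_isRegularOfDegree
    (fun x k => x.elim (fun x => if x.2.2 = 0 ∧ k = 0 then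
        (if x.2.1 = Fin.last n then .inr () else .inl (x.1, x.2.1 + 1, k)) else .inl (x.1, x.2.1, k))
      (fun _ => .inl (k, 0, 0)))
    (fun x j => x.elim (fun x => if j = 0 ∧ x.2.2 = 0 then
        (if x.2.1 = 0 then .inr () else .inl (x.1, x.2.1 - 1, j)) else .inl (x.1, x.2.1, j))
      (fun _ => .inl (j, Fin.last n, 0))) ?_ ?_ ?_ ?_⟩
  · rintro (⟨c, i, j⟩ | _) k k' h
    · simp only [Sum.elim_inl] at h
      split_ifs at h <;> simp_all
    · simpa using h
  · rintro (⟨c, i, j⟩ | _) k k' h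
    · simp only [Sum.elim_inl] at h
      split_ifs at h <;> simp_all
    · simpa using h
  · rintro (⟨c, i, j⟩ | _) (⟨c', i', k⟩ | _)
    · simp only [parallelRel, Sum.elim_inl]
      have hi' := i'.2
      constructor
      · rintro ⟨rfl, ⟨rfl, h⟩ | ⟨h, rfl, rfl⟩⟩
        · exact ⟨k, by rw [if_neg h]⟩
        · refine ⟨0, ?_⟩
          have hl : i ≠ Fin.last n := by
            rintro rfl
            simp at h
            omega
          rw [if_pos ⟨rfl, rfl⟩, if_neg hl]
          simp only [Sum.inl.injEq, Prod.mk.injEq, true_and, and_true]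
          rw [Fin.ext_iff, Fin.val_add_one, if_neg hl, h]
      · rintro ⟨k', h⟩
        split_ifs at h with h1 h2
        · simp only [Sum.inl.injEq, Prod.mk.injEq] at h
          obtain ⟨rfl, rfl, rfl⟩ := h
          exact ⟨rfl, Or.inr ⟨by rw [Fin.val_add_one, if_neg h2], h1⟩⟩
        · simp only [Sum.inl.injEq, Prod.mk.injEq] at h
          obtain ⟨rfl, rfl, rfl⟩ := h
          exact ⟨rfl, Or.inl ⟨rfl, h1⟩⟩
    · simp only [parallelRel, Sum.elim_inl]
      constructor
      · rintro ⟨rfl, rfl⟩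
        exact ⟨0, by simp⟩
      · rintro ⟨k', h⟩
        split_ifs at h with h1 h2
        exact ⟨h2, h1.1⟩
    · simp only [parallelRel, Sum.elim_inr]
      constructor
      · rintro ⟨rfl, rfl⟩
        exact ⟨c', rfl⟩
      · rintro ⟨k', h⟩
        simp only [Sum.inl.injEq, Prod.mk.injEq] at h
        exact ⟨h.2.1.symm, h.2.2.symm⟩
    · simp [parallelRel]
  · rintro (⟨c, i, j⟩ | _) (⟨c', i', k⟩ | _)
    · simp only [parallelRel, Sum.elim_inl]
      have hi' := i'.2
      constructor
      · rintro ⟨rfl, ⟨rfl, h⟩ | ⟨h, rfl, rfl⟩⟩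
        · exact ⟨j, by rw [if_neg h]⟩
        · refine ⟨0, ?_⟩
          have hl : i' ≠ 0 := by
            rintro rfl
            simp at h
          rw [if_pos ⟨rfl, rfl⟩, if_neg hl]
          simp only [Sum.inl.injEq, Prod.mk.injEq, true_and, and_true]
          rw [Fin.ext_iff, Fin.val_sub_one_of_ne_zero hl, h]
          omega
      · rintro ⟨k', h⟩
        split_ifs at h with h1 h2
        · simp only [Sum.inl.injEq, Prod.mk.injEq] at h
          obtain ⟨rfl, rfl, rfl⟩ := h
          have : (i' : ℕ) ≠ 0 := fun h => h2 (Fin.ext h)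
          exact ⟨rfl, Or.inr ⟨by rw [Fin.val_sub_one_of_ne_zero h2]; omega, h1⟩⟩
        · simp only [Sum.inl.injEq, Prod.mk.injEq] at h
          obtain ⟨rfl, rfl, rfl⟩ := h
          exact ⟨rfl, Or.inl ⟨rfl, h1⟩⟩
    · simp only [parallelRel, Sum.elim_inr]
      constructor
      · rintro ⟨rfl, rfl⟩
        exact ⟨c, rfl⟩
      · rintro ⟨k', h⟩
        simp only [Sum.inl.injEq, Prod.mk.injEq] at h
        exact ⟨h.2.1.symm, h.2.2.symm⟩
    · simp only [parallelRel, Sum.elim_inl]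
      constructor
      · rintro ⟨rfl, rfl⟩
        exact ⟨0, by simp⟩
      · rintro ⟨k', h⟩
        split_ifs at h with h1 h2
        exact ⟨h2, h1.2⟩
    · simp [parallelRel]

end

/-! ### Counting perfect matchings -/

/-- Composing a permutation fixing 0 with the swap of 0 and 1, or of 0 and 2, gives permutations
moving 0, told apart by their value at 0. This is where `d ≥ 3` enters; for `d = 2` the two counts
agree. -/
theorem two_mul_card_perm_fix_le {d : ℕ} [NeZero d] (hd : 3 ≤ d) :
    2 * Nat.card {τ : Equiv.Perm (Fin d) // τ 0 = 0} ≤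
      Nat.card {τ : Equiv.Perm (Fin d) // τ 0 ≠ 0} := by
  let one : Fin d := ⟨1, by omega⟩
  let two : Fin d := ⟨2, by omega⟩
  have h1 : one ≠ 0 := by simp [one, Fin.ext_iff]
  have h2 : two ≠ 0 := by simp [two, Fin.ext_iff]
  have h12 : one ≠ two := by simp [one, two, Fin.ext_iff]
  let F : Bool × {τ : Equiv.Perm (Fin d) // τ 0 = 0} → {τ : Equiv.Perm (Fin d) // τ 0 ≠ 0} :=
    fun x => ⟨Equiv.swap 0 (if x.1 then one else two) * x.2.1, by
      rw [Equiv.Perm.mul_apply, x.2.2, Equiv.swap_apply_left]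
      split_ifs <;> assumption⟩
  have hF : Function.Injective F := by
    rintro ⟨s, τ, hτ⟩ ⟨s', τ', hτ'⟩ h
    have h : Equiv.swap 0 (if s then one else two) * τ =
      Equiv.swap 0 (if s' then one else two) * τ' := congrArg Subtype.val h
    have h0 := congrArg (fun σ : Equiv.Perm (Fin d) => σ 0) h
    simp only [Equiv.Perm.mul_apply, hτ, hτ', Equiv.swap_apply_left] at h0
    have hs : s = s' := by
      cases s <;> cases s' <;> simp_all
    subst hs
    exact Prod.ext rfl (Subtype.ext (mul_left_cancel h))
  have := Nat.card_le_card_of_injective F hF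
  simpa using this

theorem card_perm_fix_pos {d : ℕ} [NeZero d] :
    0 < Nat.card {τ : Equiv.Perm (Fin d) // τ 0 = 0} :=
  have : Nonempty {τ : Equiv.Perm (Fin d) // τ 0 = 0} := ⟨⟨1, rfl⟩⟩
  Nat.card_pos

section

variable {d n : ℕ} [NeZero d]

/-- Blocks can be matched internally and independently; `τ 0 ≠ 0` says that the deleted edge is
avoided. -/
theorem le_pm_cyclicRel :
    Nat.card {τ : Equiv.Perm (Fin d) // τ 0 ≠ 0} ^ (d * (n + 1)) ≤
      (bipFinGraph (cyclicRel d n)).pm := by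
  rw [pm_bipFinGraph]
  let F : (Fin d × Fin (n + 1) → {τ : Equiv.Perm (Fin d) // τ 0 ≠ 0}) →
      {σ : Equiv.Perm ((Fin d × Fin (n + 1) × Fin d) ⊕ Empty) // ∀ x, cyclicRel d n x (σ x)} :=
    fun τ => ⟨Equiv.sumCongr
      ⟨fun x => (x.1, x.2.1, (τ (x.1, x.2.1)).1 x.2.2),
        fun x => (x.1, x.2.1, (τ (x.1, x.2.1)).1.symm x.2.2), fun x => by simp, fun x => by simp⟩
      (Equiv.refl _), by
        rintro (⟨c, i, j⟩ | ⟨⟨⟩⟩)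
        refine ⟨rfl, Or.inl ⟨rfl, ?_⟩⟩
        rintro ⟨rfl, h⟩
        exact (τ (c, i)).2 h⟩
  have hF : Function.Injective F := by
    intro τ τ' h
    funext ⟨c, i⟩
    refine Subtype.ext (Equiv.ext fun j => ?_)
    have := congrArg (fun σ => σ.1 (.inl (c, i, j))) h
    simpa [F] using this
  have := Nat.card_le_card_of_injective F hF
  simpa [Nat.card_fun] using this

/-- The permutation which a permutation below `parallelRel` induces on a block. -/
theorem exists_block_perm {σ : Equiv.Perm ((Fin d × Fin (n + 1) × Fin d) ⊕ Unit)}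
    (hσ : ∀ x, parallelRel d n x (σ x)) (c : Fin d) (i : Fin (n + 1)) :
    ∃ τ : Equiv.Perm (Fin d),
      (∀ j, ¬ (j = 0 ∧ τ j = 0) → σ (.inl (c, i, j)) = .inl (c, i, τ j)) ∧
      (τ 0 = 0 → ∀ k, σ (.inl (c, i, 0)) ≠ .inl (c, i, k)) ∧
      (τ 0 = 0 → ∀ k, σ (.inl (c, i, k)) ≠ .inl (c, i, 0)) := by
  classical
  have hout : ∀ j, j ≠ 0 → ∃ k, σ (.inl (c, i, j)) = .inl (c, i, k) := by
    intro j hj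
    have := hσ (.inl (c, i, j))
    rcases h : σ (.inl (c, i, j)) with ⟨c', i', k⟩ | _
    · rw [h] at this
      obtain ⟨rfl, ⟨rfl, -⟩ | ⟨-, h0, -⟩⟩ := this
      · exact ⟨k, rfl⟩
      · exact absurd h0 hj
    · rw [h] at this
      exact absurd this.2 hj
  have hin : ∀ k, k ≠ 0 → ∃ j, σ (.inl (c, i, j)) = .inl (c, i, k) := by
    intro k hk
    obtain ⟨x, hx⟩ := σ.surjective (.inl (c, i, k))
    have := hσ x
    rw [hx] at this
    rcases x with ⟨c', i', j⟩ | _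
    · obtain ⟨rfl, ⟨rfl, -⟩ | ⟨-, -, h0⟩⟩ := this
      · exact ⟨j, hx⟩
      · exact absurd h0 hk
    · exact absurd this.2 hk
  have hnot : σ (.inl (c, i, 0)) ≠ .inl (c, i, 0) := by
    intro h
    have := hσ (.inl (c, i, 0))
    rw [h] at this
    obtain ⟨-, ⟨-, h0⟩ | ⟨h0, -⟩⟩ := this
    · exact h0 ⟨rfl, rfl⟩
    · omega
  -- A partner outside the block is recorded as 0. Since 00 is not an edge, `τ 0 = 0` then means
  -- exactly that the outgoing link is used.
  have hτ : ∀ j, ∃ k, σ (.inl (c, i, j)) = .inl (c, i, k) ∨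
      (k = 0 ∧ ∀ k', σ (.inl (c, i, j)) ≠ .inl (c, i, k')) := by
    intro j
    by_cases h : ∃ k, σ (.inl (c, i, j)) = .inl (c, i, k)
    · exact ⟨h.choose, Or.inl h.choose_spec⟩
    · exact ⟨0, Or.inr ⟨rfl, fun k' hk' => h ⟨k', hk'⟩⟩⟩
  choose τ hτ using hτ
  have hτeq : ∀ j k, σ (.inl (c, i, j)) = .inl (c, i, k) → τ j = k := by
    intro j k h
    rcases hτ j with h' | ⟨-, h'⟩
    · rw [h] at h'
      simp only [Sum.inl.injEq, Prod.mk.injEq, true_and] at h'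
      exact h'.symm
    · exact absurd h (h' k)
  have hτne : ∀ j, τ j ≠ 0 → σ (.inl (c, i, j)) = .inl (c, i, τ j) :=
    fun j hj => (hτ j).resolve_right fun h => hj h.1
  -- Right vertices other than 0 are always matched inside. If 0 were missed, the default would
  -- never occur, so `τ` would inherit injectivity from `σ` and be onto.
  have hsurj : Function.Surjective τ := by
    intro k
    by_cases hk : k = 0
    · subst hk
      by_contra hno
      have hne : ∀ j, τ j ≠ 0 := fun j hj => hno ⟨j, hj⟩
      have hinj : Function.Injective τ := by
        intro j j' h
        have : σ (.inl (c, i, j)) = σ (.inl (c, i, j')) := by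
          rw [hτne j (hne j), hτne j' (hne j'), h]
        simpa using σ.injective this
      obtain ⟨j, hj⟩ := (Finite.injective_iff_surjective.mp hinj) 0
      exact hne j hj
    · obtain ⟨j, hj⟩ := hin k hk
      exact ⟨j, hτeq j k hj⟩
  have hbij : Function.Bijective τ := ⟨Finite.injective_iff_surjective.mpr hsurj, hsurj⟩
  refine ⟨Equiv.ofBijective τ hbij, ?_, ?_, ?_⟩
  · intro j hj
    rw [Equiv.ofBijective_apply] at hj ⊢
    by_cases h0 : j = 0
    · exact hτne j fun h => hj ⟨h0, h⟩
    · obtain ⟨k, hk⟩ := hout j h0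
      rw [hτeq j k hk, hk]
  · intro h k hk
    rw [Equiv.ofBijective_apply] at h
    have := hτeq 0 k hk
    rw [h] at this
    exact hnot (this ▸ hk)
  · intro h k hk
    rw [Equiv.ofBijective_apply] at h
    have := hbij.1 ((hτeq k 0 hk).trans h.symm)
    subst this
    exact hnot hk

/-- A block uses its outgoing link iff it uses its incoming one, so this state is constant along
each chain. At the first block it is decided by the partner of the left extra vertex. Thus `c₀` and
`τ` determine `σ`. -/
theorem exists_block_perms {σ : Equiv.Perm ((Fin d × Fin (n + 1) × Fin d) ⊕ Unit)}
    (hσ : ∀ x, parallelRel d n x (σ x)) :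
    ∃ (c₀ : Fin d) (τ : Fin d × Fin (n + 1) → Equiv.Perm (Fin d)),
      σ (.inr ()) = .inl (c₀, 0, 0) ∧
      (∀ x, τ x 0 = 0 ↔ x.1 = c₀) ∧
      ∀ x j, σ (.inl (x.1, x.2, j)) = if j = 0 ∧ τ x j = 0 then
        (if h : (x.2 : ℕ) < n then .inl (x.1, ⟨x.2 + 1, by omega⟩, 0) else .inr ())
        else .inl (x.1, x.2, τ x j) := by
  choose τ h1 h2 h3 using fun x : Fin d × Fin (n + 1) => exists_block_perm hσ x.1 x.2
  obtain ⟨c₀, hc₀⟩ : ∃ c₀, σ (.inr ()) = .inl (c₀, 0, 0) := by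
    have := hσ (.inr ())
    rcases h : σ (.inr ()) with ⟨c, i, k⟩ | _
    · rw [h] at this
      obtain ⟨rfl, rfl⟩ := this
      exact ⟨c, rfl⟩
    · rw [h] at this
      exact this.elim
  have hnext : ∀ x, τ x 0 = 0 → σ (.inl (x.1, x.2, 0)) =
      if h : (x.2 : ℕ) < n then .inl (x.1, ⟨x.2 + 1, by omega⟩, 0) else .inr () := by
    rintro ⟨c, i⟩ hx
    have hr := hσ (.inl (c, i, 0))
    have hn := h2 (c, i) hx
    dsimp only at hn ⊢
    rcases h : σ (.inl (c, i, 0)) with ⟨c', i', k⟩ | _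
    · rw [h] at hr hn
      obtain ⟨rfl, ⟨rfl, -⟩ | ⟨hi, -, rfl⟩⟩ := hr
      · exact absurd rfl (hn k)
      · rw [dif_pos (by omega)]
        simp only [Sum.inl.injEq, Prod.mk.injEq, true_and, and_true]
        exact Fin.ext hi
    · rw [h] at hr
      rw [dif_neg (by rw [hr.1]; simp)]
  have hfix : ∀ c (i : Fin (n + 1)), τ (c, i) 0 = 0 ↔ c = c₀ := by
    intro c i
    have hprev : ∀ i, τ (c, i) 0 ≠ 0 → ∃ j, σ (.inl (c, i, j)) = .inl (c, i, 0) := by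
      intro i hi
      obtain ⟨j, hj⟩ := (τ (c, i)).surjective 0
      refine ⟨j, ?_⟩
      have := h1 (c, i) j (fun h => hi (h.1 ▸ h.2))
      rwa [hj] at this
    -- Induction along the chain: the right vertex 0 is matched from the preceding block, or from
    -- the extra vertex at the start, iff it is not matched inside.
    obtain ⟨i, hi⟩ := i
    induction i with
    | zero =>
      constructor
      · intro h
        obtain ⟨x, hx⟩ := σ.surjective (.inl (c, 0, 0))
        have hr := hσ x
        rw [hx] at hr
        rcases x with ⟨c', i', j⟩ | _
        · obtain ⟨rfl, ⟨rfl, -⟩ | ⟨h0, -⟩⟩ := hr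
          · exact absurd hx (h3 (c, 0) h j)
          · simp at h0
        · rw [hc₀] at hx
          simp only [Sum.inl.injEq, Prod.mk.injEq, and_true] at hx
          exact hx.symm
      · rintro rfl
        by_contra h
        obtain ⟨j, hj⟩ := hprev _ h
        have := σ.injective (hj.trans hc₀.symm)
        simp at this
    | succ i ih =>
      have hi' : i < n + 1 := by omega
      refine Iff.trans ?_ (ih hi')
      constructor
      · intro h
        obtain ⟨x, hx⟩ := σ.surjective (.inl (c, ⟨i + 1, hi⟩, 0))
        have hr := hσ x
        rw [hx] at hr
        rcases x with ⟨c', i', j⟩ | _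
        · obtain ⟨rfl, ⟨rfl, -⟩ | ⟨h0, rfl, -⟩⟩ := hr
          · exact absurd hx (h3 (c, _) h j)
          · have : i' = ⟨i, hi'⟩ := Fin.ext (by simpa using h0.symm)
            subst this
            by_contra hne
            have := h1 (c, ⟨i, hi'⟩) 0 (fun h => hne h.2)
            rw [hx] at this
            simp at this
        · exact absurd (congrArg Fin.val hr.1) (by simp)
      · intro h
        have hs := hnext (c, ⟨i, hi'⟩) h
        rw [dif_pos (by simpa using hi)] at hs
        by_contra hne
        obtain ⟨j, hj⟩ := hprev _ hne
        have := σ.injective (hj.trans hs.symm)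
        simp at this
  refine ⟨c₀, τ, hc₀, fun x => hfix x.1 x.2, ?_⟩
  intro x j
  split_ifs with hj hx
  · obtain ⟨rfl, hj⟩ := hj
    rw [hnext x hj, dif_pos hx]
  · obtain ⟨rfl, hj⟩ := hj
    rw [hnext x hj, dif_neg hx]
  · exact h1 x j hj

/-- There are `d` choices of `c₀`; at each of the `n + 1` positions one block is traversed and the
other `d - 1` are matched internally. Injectivity of the encoding suffices for the upper bound. -/
theorem pm_parallelRel_le :
    (bipFinGraph (parallelRel d n)).pm ≤
      d * (Nat.card {τ : Equiv.Perm (Fin d) // τ 0 = 0} *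
        Nat.card {τ : Equiv.Perm (Fin d) // τ 0 ≠ 0} ^ (d - 1)) ^ (n + 1) := by
  classical
  rw [pm_bipFinGraph]
  choose c τ hc hτ hσ using fun σ : {σ : Equiv.Perm ((Fin d × Fin (n + 1) × Fin d) ⊕ Unit) //
    ∀ x, parallelRel d n x (σ x)} => exists_block_perms σ.2
  let F : {σ : Equiv.Perm ((Fin d × Fin (n + 1) × Fin d) ⊕ Unit) // ∀ x, parallelRel d n x (σ x)} →
      Σ c₀ : Fin d, ∀ x : Fin d × Fin (n + 1), {τ : Equiv.Perm (Fin d) // τ 0 = 0 ↔ x.1 = c₀} :=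
    fun σ => ⟨c σ, fun x => ⟨τ σ x, hτ σ x⟩⟩
  have hF : Function.Injective F := by
    intro σ σ' h
    have h1 : c σ = c σ' := congrArg Sigma.fst h
    have h2 : τ σ = τ σ' := by
      have := congrArg (fun y : Σ c₀ : Fin d, ∀ x : Fin d × Fin (n + 1),
        {τ : Equiv.Perm (Fin d) // τ 0 = 0 ↔ x.1 = c₀} => fun x => (y.2 x).1) h
      exact this
    refine Subtype.ext (Equiv.ext ?_)
    rintro (⟨c', i, j⟩ | _)
    · rw [hσ σ (c', i) j, hσ σ' (c', i) j, h2]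
    · exact (hc σ).trans (h1 ▸ (hc σ').symm)
  refine (Nat.card_le_card_of_injective F hF).trans (le_of_eq ?_)
  rw [Nat.card_sigma]
  have hprod : ∀ c₀ : Fin d, Nat.card (∀ x : Fin d × Fin (n + 1),
      {τ : Equiv.Perm (Fin d) // τ 0 = 0 ↔ x.1 = c₀}) =
      (Nat.card {τ : Equiv.Perm (Fin d) // τ 0 = 0} *
        Nat.card {τ : Equiv.Perm (Fin d) // τ 0 ≠ 0} ^ (d - 1)) ^ (n + 1) := by
    intro c₀
    rw [Nat.card_pi, Fintype.prod_prod_type]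
    simp only [Finset.prod_const, Finset.card_univ, Fintype.card_fin]
    rw [Finset.prod_pow, ← Finset.mul_prod_erase _ _ (Finset.mem_univ c₀)]
    congr 2
    · simp
    · rw [Finset.prod_congr rfl (g := fun _ => Nat.card {τ : Equiv.Perm (Fin d) // τ 0 ≠ 0})]
      · simp
      · intro c hc
        simp [(Finset.mem_erase.mp hc).1]
  rw [Finset.sum_congr rfl fun c _ => hprod c]
  simp only [Finset.sum_const, Finset.card_univ, Fintype.card_fin, smul_eq_mul]

end

/-! ### Interleaving the families and comparing entropies -/

theorem tendsto_alternating {β : Type*} {l : Filter β} {f g : ℕ → β} (hf : Tendsto f atTop l)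
    (hg : Tendsto g atTop l) :
    Tendsto (fun n : ℕ => if Even n then f (n / 2) else g (n / 2)) atTop l := by
  have h : Tendsto (fun n : ℕ => n / 2) atTop atTop := Nat.tendsto_div_const_atTop (by norm_num)
  exact Tendsto.if' (hf.comp h) (hg.comp h)

theorem mainTheorem5 (d : ℕ) (hd : 3 ≤ d) :
    ¬ FinGraph.Estimable (FinGraph.regularBipartite d) FinGraph.pmEntropy := by
  have : NeZero d := ⟨by omega⟩
  intro hest
  let G : ℕ → FinGraph := fun n => if Even n then bipFinGraph (cyclicRel d (n / 2))
    else bipFinGraph (parallelRel d (n / 2))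
  have hG : ∀ n, G n ∈ FinGraph.regularBipartite d := by
    intro n
    dsimp only [G]
    split_ifs
    · exact cyclicRel_mem_regularBipartite
    · exact parallelRel_mem_regularBipartite
  obtain ⟨l, hl⟩ := hest G hG ⟨d, fun n v => ((hG n).2 v).le⟩ (by
    intro α r _
    refine ⟨_, (tendsto_alternating
      (tendsto_ballProb (fun n => cyclicRel d n) (fun n => isBlockChain_cyclicRel) α r)
      (tendsto_ballProb (fun n => parallelRel d n) (fun n => isBlockChain_parallelRel) α r)).congr
      fun n => ?_⟩
    dsimp only [G]
    split_ifs <;> rfl)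
  have hcyc : Tendsto (fun n => (bipFinGraph (cyclicRel d n)).pmEntropy) atTop (𝓝 l) := by
    refine (hl.comp (tendsto_id.const_mul_atTop' (r := 2) (by norm_num))).congr fun n => ?_
    have h1 : Even (2 * n) := by simp
    have h2 : 2 * n / 2 = n := by omega
    simp only [G, Function.comp_apply, id, if_pos h1]
    rw [h2]
  have hpar : Tendsto (fun n => (bipFinGraph (parallelRel d n)).pmEntropy) atTop (𝓝 l) := by
    have h : Tendsto (fun n : ℕ => 2 * n + 1) atTop atTop :=
      tendsto_atTop_mono (fun n => by simp only [id]; omega) tendsto_id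
    refine (hl.comp h).congr fun n => ?_
    have h1 : ¬ Even (2 * n + 1) := by simp
    have h2 : (2 * n + 1) / 2 = n := by omega
    simp only [G, Function.comp_apply, if_neg h1]
    rw [h2]
  have hab := two_mul_card_perm_fix_le hd
  have ha := card_perm_fix_pos (d := d)
  have hlow (n : ℕ) := le_pm_cyclicRel (d := d) (n := n)
  have hupp (n : ℕ) := pm_parallelRel_le (d := d) (n := n)
  set a := Nat.card {τ : Equiv.Perm (Fin d) // τ 0 = 0}
  set b := Nat.card {τ : Equiv.Perm (Fin d) // τ 0 ≠ 0}
  have hb : 0 < b := by omega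
  have hd0 : (0 : ℝ) < d := by exact_mod_cast (by omega : 0 < d)
  have haR : (0 : ℝ) < a := by exact_mod_cast ha
  have hbR : (0 : ℝ) < b := by exact_mod_cast hb
  have hlb : Real.log b / (2 * d) ≤ l := by
    refine ge_of_tendsto' hcyc fun n => ?_
    have hlog : (d * (n + 1) : ℝ) * Real.log b ≤ Real.log (bipFinGraph (cyclicRel d n)).pm := by
      have := Real.log_le_log (by positivity) (Nat.cast_le (α := ℝ).mpr (hlow n))
      simpa using this
    have hV : (Nat.card (bipFinGraph (cyclicRel d n)).V : ℝ) = 2 * (d * (n + 1) * d) := by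
      rw [card_bipFinGraph]
      simp [mul_assoc]
    rw [FinGraph.pmEntropy, hV]
    calc Real.log b / (2 * d) = (d * (n + 1) : ℝ) * Real.log b / (2 * (d * (n + 1) * d)) := by
          field_simp
      _ ≤ _ := by gcongr
  have hub : l ≤ (Real.log a + (d - 1) * Real.log b) / (2 * d * d) := by
    have hlim : Tendsto (fun n : ℕ => Real.log d / (2 * d * d) * (1 / ((n : ℝ) + 1)) +
        (Real.log a + (d - 1) * Real.log b) / (2 * d * d)) atTop
        (𝓝 ((Real.log a + (d - 1) * Real.log b) / (2 * d * d))) := by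
      simpa using (tendsto_one_div_add_atTop_nhds_zero_nat.const_mul
        (Real.log d / (2 * d * d))).add_const ((Real.log a + (d - 1) * Real.log b) / (2 * d * d))
    refine le_of_tendsto_of_tendsto' hpar hlim fun n => ?_
    have hV : (Nat.card (bipFinGraph (parallelRel d n)).V : ℝ) = 2 * (d * (n + 1) * d + 1) := by
      rw [card_bipFinGraph]
      simp [mul_assoc]
    have hdsub : ((d - 1 : ℕ) : ℝ) = d - 1 := by
      rw [Nat.cast_sub (by omega)]
      simp
    have hlogU : Real.log ((d * (a * b ^ (d - 1)) ^ (n + 1) : ℕ) : ℝ) =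
        Real.log d + (n + 1) * (Real.log a + (d - 1) * Real.log b) := by
      push_cast
      rw [Real.log_mul (by positivity) (by positivity), Real.log_pow,
        Real.log_mul (by positivity) (by positivity), Real.log_pow, hdsub]
      push_cast
      ring
    have hU0 : 0 ≤ Real.log d + (n + 1) * (Real.log a + (d - 1) * Real.log b) := by
      rw [← hlogU]
      exact Real.log_natCast_nonneg _
    have hlog : Real.log (bipFinGraph (parallelRel d n)).pm ≤
        Real.log d + (n + 1) * (Real.log a + (d - 1) * Real.log b) := by
      rw [← hlogU]
      -- With `Real.log 0 = 0` the bound also holds if there were no matching, so existence need not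
      -- be proved.
      rcases Nat.eq_zero_or_pos (bipFinGraph (parallelRel d n)).pm with h | h
      · rw [h]
        rw [Nat.cast_zero, Real.log_zero]
        exact Real.log_natCast_nonneg _
      · exact Real.log_le_log (by exact_mod_cast h) (Nat.cast_le.mpr (hupp n))
    rw [FinGraph.pmEntropy, hV]
    calc _ ≤ (Real.log d + (n + 1) * (Real.log a + (d - 1) * Real.log b)) /
            (2 * (d * (n + 1) * d + 1)) := by gcongr
      -- Dropping the two extra vertices from the denominator uses the nonnegativity `hU0` of the
      -- numerator.
      _ ≤ (Real.log d + (n + 1) * (Real.log a + (d - 1) * Real.log b)) /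
            (2 * (d * (n + 1) * d)) := by gcongr; linarith
      _ = _ := by field_simp
  have hlt : Real.log a < Real.log b := Real.log_lt_log haR (by exact_mod_cast (by omega : a < b))
  have hfin := hlb.trans hub
  rw [div_le_div_iff₀ (by positivity) (by positivity)] at hfin
  -- This is exactly the amount by which the cross-multiplied inequality `hfin` fails.
  have : 0 < 2 * (d : ℝ) * (Real.log b - Real.log a) := by
    have : 0 < Real.log b - Real.log a := by linarith
    positivity
  linarith
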